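/- Let $A=\begin{pmatrix}-1&1\\-1&-1\end{pmatrix}$, $d=\begin{pmatrix}1\\0\end{pmatrix}$ and $D=\{0,d\}$. An expansion of $x\in\mathbb{R}^2$ is a representation $x=\sum_{i=-\ell}^{\infty}A^{-i}d_i$ with all $d_i\in D$; its fractional part is $\{x\}=\sum_{i=1}^{\infty}A^{-i}d_i$. The tile $\mathcal F$ (the Heighway dragon) is the set of all fractional parts. Then $\mathcal F$ has positive finite Lebesgue measure. Let $\overline{x}$ be its center of mass, let $x$ be uniformly distributed on $\mathcal F$, and let $$S(n,x)=\sum_{i=0}^{n-1}\{A^ix\},$$ where for each $i$ and each $x\in\mathcal F$ the vector $\{A^ix\}$ is the fractional part of an arbitrarily chosen expansion of $A^ix$ (the choice does not matter: fractional parts are unique outside a set of measure zero). Then, as $n\to\infty$, the distribution of $2\,(S(n,x)-n\overline{x})\,n^{-1/2}$ converges weakly to a probability measure $\nu$ on $\mathbb{R}^2$ which is carried by the line $\{t\overline{x}:t\in\mathbb{R}\}$ and which is the 1-dimensional Gaussian distribution given by $$\nu\left(\{t\overline{x}:t\le 2k\}\right)=\frac{1}{\sqrt{2\pi}}\int_{-\infty}^{k}e^{-\frac12u^2}\,du\qquad\text{for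 all }k\in\mathbb{R}.$$ -/

import Mathlib

open MeasureTheory ProbabilityTheory Filter Topology
open scoped Matrix

noncomputable section

namespace NumberSystem

variable {m : ℕ}

/-- `d` is a base `A` expansion of `x` with digits in `D`: `x = ∑_{i ≥ -ℓ} A^{-i} d_i` for some `ℓ`,
all the digits lying in `D` (a set that contains `0`), and all digits before index `-ℓ` being zero. -/
structure IsExpansion (A : Matrix (Fin m) (Fin m) ℝ) (D : Set (Fin m → ℝ))
    (d : ℤ → Fin m → ℝ) (x : Fin m → ℝ) : Prop where
  mem_digits : ∀ i, d i ∈ D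
  eq_zero_of_lt : ∃ ℓ : ℕ, ∀ i : ℤ, i < -(ℓ : ℤ) → d i = 0
  hasSum : HasSum (fun i : ℤ => (A ^ (-i)) *ᵥ d i) x

/-- The fractional part `∑_{i ≥ 1} A^{-i} d_i` of an expansion `d`. -/
def fracPart (A : Matrix (Fin m) (Fin m) ℝ) (d : ℤ → Fin m → ℝ) : Fin m → ℝ :=
  ∑' j : ℕ, (A ^ (-((j : ℤ) + 1))) *ᵥ d ((j : ℤ) + 1)

/-- `z` is a fractional part `{x}` of `x`: the fractional part of some expansion of `x`. -/
def IsFracPart (A : Matrix (Fin m) (Fin m) ℝ) (D : Set (Fin m → ℝ)) (x z : Fin m → ℝ) : Prop :=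
  ∃ d : ℤ → Fin m → ℝ, IsExpansion A D d x ∧ fracPart A d = z

/-- The tile of `(A, D)`: the set of all fractional parts. -/
def tile (A : Matrix (Fin m) (Fin m) ℝ) (D : Set (Fin m → ℝ)) : Set (Fin m → ℝ) :=
  {z | ∃ x, IsFracPart A D x z}

/-- The center of mass of a set, with respect to Lebesgue measure. -/
def centerOfMass (F : Set (Fin m → ℝ)) : Fin m → ℝ :=
  ⨍ x in F, x ∂volume

/-- The uniform distribution on a set (normalized Lebesgue measure). -/
def uniform (F : Set (Fin m → ℝ)) : Measure (Fin m → ℝ) :=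
  ProbabilityTheory.cond volume F

/-- The matrix of the Heighway dragon number system. -/
def dragonA : Matrix (Fin 2) (Fin 2) ℝ := !![-1, 1; -1, -1]

/-- The digit set of the Heighway dragon number system. -/
def dragonD : Set (Fin 2 → ℝ) := {![0, 0], ![1, 0]}

/-- The Heighway dragon tile. -/
def dragonTile : Set (Fin 2 → ℝ) := tile dragonA dragonD

end NumberSystem

end

/-! ### Digit sequences and the self-affine structure of the tile. -/

noncomputable section

namespace NumberSystem

/-! Let `F` be the tile and `T` (`dragonMap`) the digit shift `T x = A x - δ(x)`, with `δ(x)` the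
first digit, coded as a sign `ε(x) = ±1` (`dragonSign`). Since `A F = F ∪ (F + d)` and `det A = 2`,
the two pieces overlap in a null set, and `F` is not null because its integer translates cover the
plane. Hence fractional parts are almost everywhere unique and `{A^i x} = T^i x`
(`ae_fracPart_eq_iterate`). Both branches of `T` carry half the mass onto `F`, so `T` preserves the
uniform measure and `ε` is a fair coin independent of `T` (`uniform_sign_inter_map`); the signs `ε ∘
T^k` are therefore i.i.d.

The one-dimensional limit comes from a cohomological equation (`dragonC_mulVec_dragonMap_sub`): with
`C = (A - 1)⁻¹` and `x̄ = C d / 2`, one has `x - x̄ = ε(x) x̄ + C (T x - x)`. Summed along an orbit,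
the last term telescopes to a bounded vector, so `S(n, x) - n x̄` is a simple random walk times
`x̄`, up to `O(1)`. The central limit theorem and Slutsky's lemma finish the proof. -/

/-- The inverse of `dragonA`. -/
def dragonB : Matrix (Fin 2) (Fin 2) ℝ := !![-1/2, -1/2; 1/2, -1/2]

/-- The nonzero digit. -/
def dragonDigit : Fin 2 → ℝ := ![1, 0]

lemma dragonA_mulVec (v : Fin 2 → ℝ) : dragonA *ᵥ v = ![-v 0 + v 1, -v 0 - v 1] := by
  ext i; fin_cases i <;> simp [dragonA, Matrix.mulVec, dotProduct, Fin.sum_univ_two]; ring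

lemma dragonB_mulVec (v : Fin 2 → ℝ) :
    dragonB *ᵥ v = ![-v 0 / 2 - v 1 / 2, v 0 / 2 - v 1 / 2] := by
  ext i; fin_cases i <;> simp [dragonB, Matrix.mulVec, dotProduct, Fin.sum_univ_two] <;> ring

lemma dragonA_mul_dragonB : dragonA * dragonB = 1 := by
  ext i j
  fin_cases i <;> fin_cases j <;>
    simp [dragonA, dragonB, Matrix.mul_apply, Fin.sum_univ_two] <;> norm_num

lemma dragonB_mul_dragonA : dragonB * dragonA = 1 :=
  mul_eq_one_comm.mp dragonA_mul_dragonB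

lemma dragonA_mulVec_dragonB_mulVec (v : Fin 2 → ℝ) : dragonA *ᵥ (dragonB *ᵥ v) = v := by
  rw [Matrix.mulVec_mulVec, dragonA_mul_dragonB, Matrix.one_mulVec]

lemma dragonB_mulVec_dragonA_mulVec (v : Fin 2 → ℝ) : dragonB *ᵥ (dragonA *ᵥ v) = v := by
  rw [Matrix.mulVec_mulVec, dragonB_mul_dragonA, Matrix.one_mulVec]

lemma det_dragonA : dragonA.det = 2 := by
  simp [dragonA, Matrix.det_fin_two]; norm_num

lemma dragonA_zpow_neg (n : ℕ) : dragonA ^ (-(n : ℤ)) = dragonB ^ n := by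
  rw [Matrix.zpow_neg_natCast, ← Matrix.inv_pow', Matrix.inv_eq_right_inv dragonA_mul_dragonB]

lemma mem_dragonD {v : Fin 2 → ℝ} : v ∈ dragonD ↔ v = 0 ∨ v = dragonDigit := by
  have : (![0, 0] : Fin 2 → ℝ) = 0 := by ext i; fin_cases i <;> rfl
  simp [dragonD, dragonDigit, this]

lemma finite_dragonD : dragonD.Finite := Set.toFinite {![0, 0], ![1, 0]}

lemma zero_mem_dragonD : (0 : Fin 2 → ℝ) ∈ dragonD := mem_dragonD.2 (.inl rfl)

lemma norm_dragonDigit : ‖dragonDigit‖ = 1 := by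
  refine le_antisymm ((pi_norm_le_iff_of_nonneg zero_le_one).2 fun i => ?_) ?_
  · fin_cases i <;> simp [dragonDigit]
  · simpa [dragonDigit] using norm_le_pi_norm dragonDigit 0

lemma norm_le_one_of_mem_dragonD {v : Fin 2 → ℝ} (hv : v ∈ dragonD) : ‖v‖ ≤ 1 := by
  rcases mem_dragonD.1 hv with rfl | rfl <;> simp [norm_dragonDigit]

/-- `B` is a rotation scaled by `1/√2`, so it scales the Euclidean norm exactly. -/
lemma sq_add_sq_dragonB_pow (n : ℕ) (v : Fin 2 → ℝ) :
    ((dragonB ^ n) *ᵥ v) 0 ^ 2 + ((dragonB ^ n) *ᵥ v) 1 ^ 2 =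
      (1 / 2) ^ n * (v 0 ^ 2 + v 1 ^ 2) := by
  induction n with
  | zero => simp
  | succ n ih =>
    rw [pow_succ' dragonB, ← Matrix.mulVec_mulVec, dragonB_mulVec, pow_succ (1 / 2 : ℝ),
      mul_right_comm, ← ih]
    simp only [Matrix.cons_val_zero, Matrix.cons_val_one]
    ring

/-- The norm here is the sup norm; comparison with the Euclidean norm costs a factor `√2`, rounded
up to `2`. -/
lemma norm_dragonB_pow_mulVec_le (n : ℕ) (v : Fin 2 → ℝ) :
    ‖(dragonB ^ n) *ᵥ v‖ ≤ 2 * √(1 / 2) ^ n * ‖v‖ := by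
  have h0 : v 0 ^ 2 ≤ ‖v‖ ^ 2 := sq_le_sq' (by
    linarith [neg_abs_le (v 0), norm_le_pi_norm v 0, Real.norm_eq_abs (v 0)])
    ((le_abs_self _).trans (norm_le_pi_norm v 0))
  have h1 : v 1 ^ 2 ≤ ‖v‖ ^ 2 := sq_le_sq' (by
    linarith [neg_abs_le (v 1), norm_le_pi_norm v 1, Real.norm_eq_abs (v 1)])
    ((le_abs_self _).trans (norm_le_pi_norm v 1))
  have hsq : (2 * √(1 / 2) ^ n * ‖v‖) ^ 2 = 4 * ((1 / 2) ^ n * ‖v‖ ^ 2) := by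
    rw [mul_pow, mul_pow, ← pow_mul, mul_comm n 2, pow_mul, Real.sq_sqrt (by norm_num)]; ring
  have hq := sq_add_sq_dragonB_pow n v
  have hp : (0 : ℝ) < (1 / 2) ^ n := by positivity
  have hle := mul_le_mul_of_nonneg_left (add_le_add h0 h1) hp.le
  have hpos : 0 ≤ (1 / 2 : ℝ) ^ n * ‖v‖ ^ 2 := by positivity
  have hnn : 0 ≤ 2 * √(1 / 2) ^ n * ‖v‖ := by positivity
  refine (pi_norm_le_iff_of_nonneg hnn).2 fun i => ?_
  rw [Real.norm_eq_abs]
  refine abs_le_of_sq_le_sq ?_ hnn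
  rw [hsq]
  fin_cases i <;> simp only [Fin.zero_eta, Fin.mk_one] <;>
    nlinarith [sq_nonneg (((dragonB ^ n) *ᵥ v) 0), sq_nonneg (((dragonB ^ n) *ᵥ v) 1)]

lemma sqrt_half_lt_one : √(1 / 2 : ℝ) < 1 := by
  rw [Real.sqrt_lt' one_pos]; norm_num

lemma summable_two_mul_sqrt_half_pow : Summable fun j : ℕ => 2 * √(1 / 2 : ℝ) ^ (j + 1) :=
  ((summable_nat_add_iff 1).2
    (summable_geometric_of_lt_one (Real.sqrt_nonneg _) sqrt_half_lt_one)).mul_left 2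

lemma norm_dragonB_pow_mulVec_le_of_mem {v : Fin 2 → ℝ} (hv : v ∈ dragonD) (n : ℕ) :
    ‖(dragonB ^ n) *ᵥ v‖ ≤ 2 * √(1 / 2) ^ n :=
  (norm_dragonB_pow_mulVec_le n v).trans
    (mul_le_of_le_one_right (by positivity) (norm_le_one_of_mem_dragonD hv))

lemma summable_dragonB_pow_mulVec {s : ℕ → Fin 2 → ℝ} (hs : ∀ j, s j ∈ dragonD) :
    Summable fun j : ℕ => (dragonB ^ (j + 1)) *ᵥ s j :=
  Summable.of_norm_bounded summable_two_mul_sqrt_half_pow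
    fun j => norm_dragonB_pow_mulVec_le_of_mem (hs j) _

lemma continuous_mulVec (M : Matrix (Fin 2) (Fin 2) ℝ) : Continuous fun v => M *ᵥ v :=
  continuous_const.matrix_mulVec continuous_id

/-- The value of a sequence of digits placed after the radix point. -/
def digitSum (s : ℕ → Fin 2 → ℝ) : Fin 2 → ℝ := ∑' j : ℕ, (dragonB ^ (j + 1)) *ᵥ s j

lemma digitSum_eq {s : ℕ → Fin 2 → ℝ} (hs : ∀ j, s j ∈ dragonD) :
    digitSum s = dragonB *ᵥ (digitSum (fun j => s (j + 1)) + s 0) := by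
  have h : digitSum (fun j => s (j + 1)) = ∑' j : ℕ, (dragonB ^ (j + 1)) *ᵥ s (j + 1) := rfl
  rw [digitSum, (summable_dragonB_pow_mulVec hs).tsum_eq_zero_add, Matrix.mulVec_add, h, add_comm,
    zero_add, pow_one]
  congr 1
  have := (summable_dragonB_pow_mulVec fun j => hs (j + 1)).map_tsum
    (Matrix.mulVecLin dragonB) (continuous_mulVec dragonB)
  simp only [Matrix.mulVecLin_apply, Matrix.mulVec_mulVec] at this
  rw [this]
  simp only [← pow_succ']

lemma fracPart_dragonA (d : ℤ → Fin 2 → ℝ) :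
    fracPart dragonA d = digitSum fun j => d ((j : ℤ) + 1) := by
  unfold fracPart digitSum
  refine tsum_congr fun j => ?_
  rw [← dragonA_zpow_neg]; push_cast; rfl

lemma isFracPart_digitSum {s : ℕ → Fin 2 → ℝ} (hs : ∀ j, s j ∈ dragonD) :
    IsFracPart dragonA dragonD (digitSum s) (digitSum s) := by
  let d : ℤ → Fin 2 → ℝ := fun i => if 1 ≤ i then s (i - 1).toNat else 0
  have hd : ∀ j : ℕ, d ((j : ℤ) + 1) = s j := fun j => by
    have : (1 : ℤ) ≤ j + 1 := by omega
    simp [d]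
  refine ⟨d, ⟨fun i => ?_, ⟨0, fun i hi => ?_⟩, ?_⟩, ?_⟩
  · by_cases h : 1 ≤ i
    · simpa [d, h] using hs _
    · simpa [d, h] using zero_mem_dragonD
  · have : ¬ 1 ≤ i := by simp at hi; omega
    simp [d, this]
  · have hinj : Function.Injective fun j : ℕ => (j : ℤ) + 1 := fun a b h => by
      simpa using h
    rw [← hinj.hasSum_iff]
    · have : ((fun i : ℤ => (dragonA ^ (-i)) *ᵥ d i) ∘ fun j : ℕ => (j : ℤ) + 1) =
          fun j : ℕ => (dragonB ^ (j + 1)) *ᵥ s j := by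
        funext j
        simp only [Function.comp_apply, hd, ← dragonA_zpow_neg]
        push_cast; rfl
      rw [this]
      exact (summable_dragonB_pow_mulVec hs).hasSum
    · intro i hi
      have : ¬ 1 ≤ i := fun h => hi ⟨(i - 1).toNat, by simp only; omega⟩
      simp [d, this]
  · rw [fracPart_dragonA]; simp only [hd]

lemma mem_dragonTile {z : Fin 2 → ℝ} :
    z ∈ dragonTile ↔ ∃ s : ℕ → Fin 2 → ℝ, (∀ j, s j ∈ dragonD) ∧ digitSum s = z := by
  constructor
  · rintro ⟨x, d, hd, rfl⟩
    exact ⟨_, fun j => hd.mem_digits _, (fracPart_dragonA d).symm⟩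
  · rintro ⟨s, hs, rfl⟩
    exact ⟨_, isFracPart_digitSum hs⟩

/-- The tile is the image of the compact space of digit sequences under a uniformly convergent,
hence continuous, sum. -/
lemma isCompact_dragonTile : IsCompact dragonTile := by
  have hK : IsCompact (Set.pi Set.univ fun _ : ℕ => dragonD) :=
    isCompact_univ_pi fun _ => finite_dragonD.isCompact
  have hc : ContinuousOn digitSum (Set.pi Set.univ fun _ : ℕ => dragonD) := by
    refine continuousOn_tsum (fun j => ?_) summable_two_mul_sqrt_half_pow
      fun j s hs => norm_dragonB_pow_mulVec_le_of_mem (hs j trivial) _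
    exact ((continuous_mulVec _).comp (continuous_apply j)).continuousOn
  convert hK.image_of_continuousOn hc
  ext z
  simp [mem_dragonTile]

lemma measurableSet_dragonTile : MeasurableSet dragonTile :=
  isCompact_dragonTile.measurableSet

/-- Self-affinity `A F = F ∪ (F + d)`: drop or prepend a first digit. -/
lemma mem_dragonTile_iff_mulVec {z : Fin 2 → ℝ} :
    z ∈ dragonTile ↔ dragonA *ᵥ z ∈ dragonTile ∨ dragonA *ᵥ z - dragonDigit ∈ dragonTile := by
  have key : ∀ y ∈ dragonTile, ∀ δ ∈ dragonD, dragonB *ᵥ (y + δ) ∈ dragonTile := by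
    intro y hy δ hδ
    obtain ⟨s, hs, rfl⟩ := mem_dragonTile.1 hy
    have hs' : ∀ j, (fun j => Nat.casesOn j δ s : ℕ → Fin 2 → ℝ) j ∈ dragonD := by
      rintro (_ | j)
      · exact hδ
      · exact hs j
    exact mem_dragonTile.2 ⟨_, hs', digitSum_eq hs'⟩
  constructor
  · intro hz
    obtain ⟨s, hs, rfl⟩ := mem_dragonTile.1 hz
    rw [digitSum_eq hs, dragonA_mulVec_dragonB_mulVec]
    have ht : digitSum (fun j => s (j + 1)) ∈ dragonTile :=
      mem_dragonTile.2 ⟨_, fun j => hs (j + 1), rfl⟩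
    rcases mem_dragonD.1 (hs 0) with h | h <;> simp [h, ht]
  · rintro (h | h)
    · simpa only [add_zero, dragonB_mulVec_dragonA_mulVec] using key _ h 0 zero_mem_dragonD
    · simpa only [sub_add_cancel, dragonB_mulVec_dragonA_mulVec] using
      key _ h _ (mem_dragonD.2 (.inr rfl))

lemma zero_mem_dragonTile : (0 : Fin 2 → ℝ) ∈ dragonTile :=
  mem_dragonTile.2 ⟨fun _ => 0, fun _ => zero_mem_dragonD, by simp [digitSum]⟩

/-- The values of the integer parts with `n` digits. -/
def integerParts : ℕ → Set (Fin 2 → ℝ)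
  | 0 => {0}
  | n + 1 => {g | ∃ h ∈ integerParts n, ∃ δ ∈ dragonD, g = dragonA *ᵥ h + δ}

lemma sum_mem_integerParts (n : ℕ) {s : ℕ → Fin 2 → ℝ} (hs : ∀ j, s j ∈ dragonD) :
    ∑ m ∈ Finset.range n, (dragonA ^ m) *ᵥ s m ∈ integerParts n := by
  induction n generalizing s with
  | zero => simp [integerParts]
  | succ n ih =>
    refine ⟨_, ih fun j => hs (j + 1), s 0, hs 0, ?_⟩
    rw [Finset.sum_range_succ', Matrix.mulVec_sum]
    simp only [Matrix.mulVec_mulVec, pow_succ', pow_zero, Matrix.one_mulVec]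

/-- Leading zeros are allowed, so integer parts of different lengths can be compared at a common
length. -/
lemma monotone_integerParts : Monotone integerParts := by
  refine monotone_nat_of_le_succ fun n => ?_
  induction n with
  | zero =>
    rintro g rfl
    exact ⟨0, rfl, 0, zero_mem_dragonD, by simp⟩
  | succ n ih =>
    rintro g ⟨h, hh, δ, hδ, rfl⟩
    exact ⟨h, ih hh, δ, hδ, rfl⟩

lemma countable_integerParts (n : ℕ) : (integerParts n).Countable := by
  induction n with
  | zero => exact Set.countable_singleton _
  | succ n ih =>
    have hD : dragonD.Countable := finite_dragonD.countable
    refine (ih.image2 hD fun h δ => dragonA *ᵥ h + δ).mono ?_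
    rintro g ⟨h, hh, δ, hδ, rfl⟩
    exact ⟨h, hh, δ, hδ, rfl⟩

lemma IsFracPart.mem_dragonTile {x z : Fin 2 → ℝ} (h : IsFracPart dragonA dragonD x z) :
    z ∈ dragonTile := ⟨x, h⟩

lemma IsFracPart.exists_integerPart {x z : Fin 2 → ℝ} (h : IsFracPart dragonA dragonD x z) :
    ∃ n, x - z ∈ integerParts n := by
  obtain ⟨d, ⟨hd, ⟨ℓ, hℓ⟩, hx⟩, rfl⟩ := h
  have hinj : Function.Injective fun n : ℕ => (n : ℤ) - ℓ := fun a b h => by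
    simpa using h
  rw [← hinj.hasSum_iff] at hx
  -- The integer part uses the indices `-ℓ, ..., 0`, hence `ℓ + 1` digits.
  · refine ⟨ℓ + 1, ?_⟩
    have hsplit := hx.summable.sum_add_tsum_nat_add (ℓ + 1)
    rw [hx.tsum_eq] at hsplit
    have hfrac : ∑' i : ℕ, ((fun i : ℤ => (dragonA ^ (-i)) *ᵥ d i) ∘ fun n : ℕ => (n : ℤ) - ℓ)
        (i + (ℓ + 1)) = fracPart dragonA d := by
      refine tsum_congr fun i => ?_
      have : ((i + (ℓ + 1) : ℕ) : ℤ) - ℓ = (i : ℤ) + 1 := by push_cast; ring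
      simp only [Function.comp_apply, this]
    rw [hfrac] at hsplit
    rw [← hsplit, add_sub_cancel_right, ← Finset.sum_range_reflect]
    convert sum_mem_integerParts (ℓ + 1) (s := fun m => d (-(m : ℤ))) (fun m => hd _) using 1
    refine Finset.sum_congr rfl fun m hm => ?_
    have : ((ℓ + 1 - 1 - m : ℕ) : ℤ) - ℓ = -(m : ℤ) := by
      have := Finset.mem_range.1 hm
      omega
    simp only [Function.comp_apply, this, neg_neg, zpow_natCast]
  · intro i hi
    have : i < -(ℓ : ℤ) := by
      by_contra hcon
      exact hi ⟨(i + ℓ).toNat, by simp; omega⟩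
    simp [hℓ i this]

end NumberSystem

end

/-! ### Covering by lattice translates, null overlaps, uniqueness of fractional parts. -/

noncomputable section

namespace NumberSystem

/-- The lattice `ℤ²`. -/
def intLattice : Set (Fin 2 → ℝ) := Set.pi Set.univ fun _ => Set.range ((↑) : ℤ → ℝ)

lemma mem_intLattice {v : Fin 2 → ℝ} :
    v ∈ intLattice ↔ ∃ a b : ℤ, v = ![(a : ℝ), (b : ℝ)] := by
  constructor
  · intro h
    obtain ⟨a, ha⟩ := h 0 trivial
    obtain ⟨b, hb⟩ := h 1 trivial
    exact ⟨a, b, by ext i; fin_cases i <;> simp [ha, hb]⟩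
  · rintro ⟨a, b, rfl⟩ i -
    fin_cases i <;> simp

lemma isClosed_intLattice : IsClosed intLattice :=
  isClosed_set_pi fun _ _ => Int.isClosedEmbedding_coe_real.isClosed_range

lemma countable_intLattice : intLattice.Countable := by
  refine (Set.countable_range fun p : ℤ × ℤ => ![(p.1 : ℝ), (p.2 : ℝ)]).mono fun v hv => ?_
  obtain ⟨a, b, rfl⟩ := mem_intLattice.1 hv
  exact ⟨(a, b), rfl⟩

/-- `A ℤ²` is the index-two sublattice of vectors with even coordinate sum, and `d` represents the
other coset. -/
lemma exists_intLattice_residue {k : Fin 2 → ℝ} (hk : k ∈ intLattice) :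
    ∃ m ∈ intLattice, k = dragonA *ᵥ m ∨ k = dragonA *ᵥ m + dragonDigit := by
  obtain ⟨a, b, rfl⟩ := mem_intLattice.1 hk
  rcases Int.even_or_odd' (a + b) with ⟨c, hc | hc⟩
  · refine ⟨![((-c : ℤ) : ℝ), ((c - b : ℤ) : ℝ)], mem_intLattice.2 ⟨_, _, rfl⟩, .inl ?_⟩
    have : (a : ℝ) = 2 * c - b := by exact_mod_cast eq_sub_of_add_eq hc
    rw [dragonA_mulVec]
    ext i; fin_cases i <;> simp [this]; ring
  · refine ⟨![((-c : ℤ) : ℝ), ((c - b : ℤ) : ℝ)], mem_intLattice.2 ⟨_, _, rfl⟩, .inr ?_⟩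
    have : (a : ℝ) = 2 * c + 1 - b := by exact_mod_cast eq_sub_of_add_eq hc
    rw [dragonA_mulVec]
    ext i; fin_cases i <;> simp [this, dragonDigit]; ring

open scoped Pointwise in
-- Write `k = A m + δ`; then `B (k + f) = m + B (f + δ)`, and `B (f + δ)` lies in the tile again.
lemma dragonB_mulVec_mem_add {x : Fin 2 → ℝ} (hx : x ∈ intLattice + dragonTile) :
    dragonB *ᵥ x ∈ intLattice + dragonTile := by
  obtain ⟨k, hk, f, hf, rfl⟩ := Set.mem_add.1 hx
  obtain ⟨m, hm, h | h⟩ := exists_intLattice_residue hk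
  · refine Set.mem_add.2 ⟨m, hm, dragonB *ᵥ f, mem_dragonTile_iff_mulVec.2 (.inl ?_), ?_⟩
    · rwa [dragonA_mulVec_dragonB_mulVec]
    · rw [h, Matrix.mulVec_add, dragonB_mulVec_dragonA_mulVec]
  · refine Set.mem_add.2
      ⟨m, hm, dragonB *ᵥ (f + dragonDigit), mem_dragonTile_iff_mulVec.2 (.inr ?_), ?_⟩
    · rwa [dragonA_mulVec_dragonB_mulVec, add_sub_cancel_right]
    · rw [h, add_assoc, Matrix.mulVec_add dragonB (dragonA *ᵥ m), dragonB_mulVec_dragonA_mulVec,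
        add_comm f]

open scoped Pointwise in
-- The set is closed, stable under `B` and contains `ℤ²`, so it contains every refined lattice `B^n
-- ℤ²`; these approximate any point.
lemma intLattice_add_dragonTile : intLattice + dragonTile = Set.univ := by
  have hclosed : IsClosed (intLattice + dragonTile) :=
    isClosed_intLattice.add_right_of_isCompact isCompact_dragonTile
  refine Set.eq_univ_of_forall fun x => ?_
  have hpow : ∀ (n : ℕ) y, y ∈ intLattice + dragonTile →
      (dragonB ^ n) *ᵥ y ∈ intLattice + dragonTile := by
    intro n y hy
    induction n with
    | zero => simpa using! hy
    | succ n ih =>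
      rw [pow_succ', ← Matrix.mulVec_mulVec]
      exact dragonB_mulVec_mem_add ih
  let k : ℕ → Fin 2 → ℝ := fun n i => (⌊((dragonA ^ n) *ᵥ x) i⌋ : ℤ)
  have hk : ∀ n, k n ∈ intLattice + dragonTile := fun n =>
    Set.mem_add.2 ⟨k n, fun i _ => ⟨_, rfl⟩, 0, zero_mem_dragonTile, add_zero _⟩
  have hinv : ∀ n : ℕ, (dragonB ^ n) *ᵥ ((dragonA ^ n) *ᵥ x) = x := fun n => by
    rw [Matrix.mulVec_mulVec, ← (Commute.mul_pow (a := dragonB) (b := dragonA) ?_ n),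
      dragonB_mul_dragonA, one_pow, Matrix.one_mulVec]
    rw [commute_iff_eq, dragonA_mul_dragonB, dragonB_mul_dragonA]
  have hlim : Tendsto (fun n => (dragonB ^ n) *ᵥ k n) atTop (𝓝 x) := by
    rw [tendsto_iff_norm_sub_tendsto_zero]
    have h0 : Tendsto (fun n : ℕ => 2 * √(1 / 2 : ℝ) ^ n * 1) atTop (𝓝 0) := by
      simpa using ((tendsto_pow_atTop_nhds_zero_of_lt_one (Real.sqrt_nonneg _)
        sqrt_half_lt_one).const_mul 2).mul_const 1
    refine squeeze_zero (fun _ => norm_nonneg _) (fun n => ?_) h0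
    have hdiff : (dragonB ^ n) *ᵥ k n - x =
        (dragonB ^ n) *ᵥ (k n - (dragonA ^ n) *ᵥ x) := by rw [Matrix.mulVec_sub, hinv]
    rw [hdiff]
    refine (norm_dragonB_pow_mulVec_le n _).trans ?_
    refine mul_le_mul_of_nonneg_left ?_ (by positivity)
    refine (pi_norm_le_iff_of_nonneg zero_le_one).2 fun i => ?_
    rw [Pi.sub_apply, Real.norm_eq_abs, abs_le]
    constructor <;>
    linarith [Int.floor_le (((dragonA ^ n) *ᵥ x) i), Int.lt_floor_add_one (((dragonA ^ n) *ᵥ x) i)]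
  exact hclosed.mem_of_tendsto hlim (Eventually.of_forall fun n => hpow n _ (hk n))

lemma volume_preimage_sub (v : Fin 2 → ℝ) (s : Set (Fin 2 → ℝ)) :
    volume ((fun x => x - v) ⁻¹' s) = volume s := by
  simp only [sub_eq_add_neg, measure_preimage_add_right]

lemma volume_dragonTile_ne_zero : volume dragonTile ≠ 0 := by
  intro h
  have hcover : (Set.univ : Set (Fin 2 → ℝ)) ⊆
      ⋃ k ∈ intLattice, (fun x => x - k) ⁻¹' dragonTile := by
    intro x _
    have hx := intLattice_add_dragonTile.symm ▸ Set.mem_univ x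
    obtain ⟨k, hk, f, hf, rfl⟩ := Set.mem_add.1 hx
    simp only [Set.mem_iUnion]
    exact ⟨k, hk, by simpa using! hf⟩
  have hnull : volume (⋃ k ∈ intLattice, (fun x => x - k) ⁻¹' dragonTile) = 0 := by
    refine (measure_biUnion_null_iff countable_intLattice).2 fun k _ => ?_
    rw [volume_preimage_sub, h]
  have := measure_mono_null hcover hnull
  simp at this

lemma volume_dragonTile_ne_top : volume dragonTile ≠ ⊤ :=
  isCompact_dragonTile.measure_lt_top.ne

lemma measurable_mulVec (M : Matrix (Fin 2) (Fin 2) ℝ) : Measurable fun v => M *ᵥ v :=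
  (continuous_mulVec M).measurable

lemma volume_preimage_dragonA (s : Set (Fin 2 → ℝ)) :
    volume ((fun x => dragonA *ᵥ x) ⁻¹' s) = 2⁻¹ * volume s := by
  have hdet : LinearMap.det (Matrix.toLin' dragonA) = 2 := by
    rw [LinearMap.det_toLin', det_dragonA]
  have := Measure.addHaar_preimage_linearMap (volume : Measure (Fin 2 → ℝ))
    (f := Matrix.toLin' dragonA) (by rw [hdet]; norm_num) s
  rw [hdet] at this
  convert! this using 2
  rw [abs_of_pos (by norm_num), ENNReal.ofReal_inv_of_pos (by norm_num)]
  simp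

/-- Self-affinity and `det A = 2` give `|F ∪ (F + d)| = 2 |F| = |F| + |F + d|`; finiteness of `|F|`
leaves no room for overlap. -/
lemma volume_dragonTile_inter_translate :
    volume (dragonTile ∩ (fun x => x - dragonDigit) ⁻¹' dragonTile) = 0 := by
  have hunion : dragonTile = (fun x => dragonA *ᵥ x) ⁻¹'
      (dragonTile ∪ (fun x => x - dragonDigit) ⁻¹' dragonTile) := by
    ext x; exact mem_dragonTile_iff_mulVec
  have h2 := volume_preimage_dragonA (dragonTile ∪ (fun x => x - dragonDigit) ⁻¹' dragonTile)
  rw [← hunion] at h2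
  have hadd := measure_union_add_inter (μ := volume) dragonTile
    (measurableSet_dragonTile.preimage (measurable_id.sub_const dragonDigit))
  have hsub := volume_preimage_sub dragonDigit dragonTile
  have hU : volume (dragonTile ∪ (fun x => x - dragonDigit) ⁻¹' dragonTile) =
      volume dragonTile + volume dragonTile := by
    rw [← two_mul, h2, ← mul_assoc, ENNReal.mul_inv_cancel (by simp) (by simp), one_mul]
  simp only [id] at hadd
  rw [hsub, hU] at hadd
  have hfin : volume dragonTile + volume dragonTile ≠ ⊤ :=
    ENNReal.add_ne_top.2 ⟨volume_dragonTile_ne_top, volume_dragonTile_ne_top⟩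
  exact (ENNReal.add_right_inj hfin).1 (hadd.trans (add_zero _).symm)

/-- Induction on length. If the last digits are removed and the leading parts still differ, `A⁻¹`
maps the overlap into an overlap of the previous level; if they agree, the overlap is empty of mass
by the case `F`, `F + d`. -/
lemma volume_translate_inter_translate (n : ℕ) :
    ∀ g ∈ integerParts n, ∀ g' ∈ integerParts n, g ≠ g' →
      volume ((fun x => x - g) ⁻¹' dragonTile ∩ (fun x => x - g') ⁻¹' dragonTile) = 0 := by
  induction n with
  | zero =>
    rintro g rfl g' rfl h
    exact absurd rfl h
  | succ n ih =>
    rintro g ⟨h, hh, δ, hδ, rfl⟩ g' ⟨h', hh', δ', hδ', rfl⟩ hne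
    by_cases heq : h = h'
    · subst heq
      have key : volume ((fun x => x - (dragonA *ᵥ h + 0)) ⁻¹' dragonTile ∩
          (fun x => x - (dragonA *ᵥ h + dragonDigit)) ⁻¹' dragonTile) = 0 := by
        refine Eq.trans ?_ ((volume_preimage_sub (dragonA *ᵥ h) _).trans
          volume_dragonTile_inter_translate)
        congr 1
        ext x
        simp only [Set.mem_inter_iff, Set.mem_preimage, add_zero, sub_sub]
      rcases mem_dragonD.1 hδ with rfl | rfl <;> rcases mem_dragonD.1 hδ' with rfl | rfl
      · exact absurd rfl hne
      · exact key
      · rwa [Set.inter_comm]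
      · exact absurd rfl hne
    · have hsub : ∀ h : Fin 2 → ℝ, ∀ δ ∈ dragonD, ∀ x,
          dragonA *ᵥ x - (dragonA *ᵥ h + δ) ∈ dragonTile → x - h ∈ dragonTile := by
        intro h δ hδ x hx
        rw [mem_dragonTile_iff_mulVec, Matrix.mulVec_sub]
        rcases mem_dragonD.1 hδ with rfl | rfl
        · left; simpa only [add_zero] using hx
        · right; rwa [sub_sub]
      have hss : (fun x => dragonA *ᵥ x) ⁻¹' ((fun x => x - (dragonA *ᵥ h + δ)) ⁻¹' dragonTile ∩
          (fun x => x - (dragonA *ᵥ h' + δ')) ⁻¹' dragonTile) ⊆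
          (fun x => x - h) ⁻¹' dragonTile ∩ (fun x => x - h') ⁻¹' dragonTile :=
        fun x hx => ⟨hsub h δ hδ x hx.1, hsub h' δ' hδ' x hx.2⟩
      have h0 := measure_mono_null hss (ih h hh h' hh' heq)
      rw [volume_preimage_dragonA] at h0
      simpa using h0

lemma ae_eq_of_mem_integerParts : ∀ᵐ x : Fin 2 → ℝ, ∀ n,
    ∀ g ∈ integerParts n, ∀ g' ∈ integerParts n,
      x - g ∈ dragonTile → x - g' ∈ dragonTile → g = g' := by
  refine ae_all_iff.2 fun n => ?_
  refine (ae_ball_iff (countable_integerParts n)).2 fun g hg => ?_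
  refine (ae_ball_iff (countable_integerParts n)).2 fun g' hg' => ?_
  by_cases h : g = g'
  · exact Eventually.of_forall fun _ _ _ => h
  · have h0 := measure_eq_zero_iff_ae_notMem.1
      (volume_translate_inter_translate n g hg g' hg' h)
    filter_upwards [h0] with x hx h1 h2
    exact absurd ⟨h1, h2⟩ hx

lemma ae_dragonA_pow_mulVec {p : (Fin 2 → ℝ) → Prop} (hp : ∀ᵐ x, p x) (n : ℕ) :
    ∀ᵐ x, p ((dragonA ^ n) *ᵥ x) := by
  induction n with
  | zero => simpa using! hp
  | succ n ih =>
    have : volume ((fun x => dragonA *ᵥ x) ⁻¹' {x | ¬ p ((dragonA ^ n) *ᵥ x)}) = 0 := by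
      rw [volume_preimage_dragonA, ae_iff.1 ih, mul_zero]
    simp only [pow_succ, ← Matrix.mulVec_mulVec]
    exact ae_iff.2 this

/-- The fractional parts of `Aⁿ x` are unique for almost every `x`. -/
lemma ae_fracPart_unique : ∀ᵐ x : Fin 2 → ℝ, ∀ i n,
    ∀ g ∈ integerParts n, ∀ g' ∈ integerParts n,
      (dragonA ^ i) *ᵥ x - g ∈ dragonTile → (dragonA ^ i) *ᵥ x - g' ∈ dragonTile → g = g' :=
  ae_all_iff.2 fun i => ae_dragonA_pow_mulVec ae_eq_of_mem_integerParts i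

end NumberSystem

end

/-! ### Independence along the iterates of a measure preserving map. -/

noncomputable section

/-- If `f` is independent of the measure preserving map `T`, the observables `f ∘ T^[k]` form an
independent sequence. -/
lemma ProbabilityTheory.IndepFun.iIndepFun_comp_iterate {Ω β : Type*} [MeasurableSpace Ω]
    [MeasurableSpace β] {μ : Measure Ω} [IsProbabilityMeasure μ] {f : Ω → β} {T : Ω → Ω}
    (hf : Measurable f) (hT : MeasurePreserving T μ μ) (h : IndepFun f T μ) :
    iIndepFun (fun k : ℕ => f ∘ T^[k]) μ := by
  classical
  have key : ∀ (n : ℕ) (S : ℕ → Set β), (∀ i, MeasurableSet (S i)) →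
      μ (⋂ i ∈ Finset.range n, (f ∘ T^[i]) ⁻¹' S i) = ∏ i ∈ Finset.range n, μ (f ⁻¹' S i) := by
    intro n
    induction n with
    | zero => intro S _; simp
    | succ n ih =>
      intro S hS
      -- Peel off time `0`: the events at later times form the `T`-preimage of an event, so
      -- independence of `f` and `T` applies.
      have hsplit : (⋂ i ∈ Finset.range (n + 1), (f ∘ T^[i]) ⁻¹' S i) =
          f ⁻¹' S 0 ∩ T ⁻¹' (⋂ i ∈ Finset.range n, (f ∘ T^[i]) ⁻¹' S (i + 1)) := by
        ext x
        simp only [Set.mem_iInter, Set.mem_inter_iff, Set.mem_preimage, Finset.mem_range,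
          Function.comp_apply]
        constructor
        · exact fun hx => ⟨hx 0 n.succ_pos, fun i hi => hx (i + 1) (Nat.succ_lt_succ hi)⟩
        · rintro ⟨h0, hx⟩ (_ | i) hi
          · exact h0
          · exact hx i (Nat.lt_of_succ_lt_succ hi)
      have hmeas : MeasurableSet (⋂ i ∈ Finset.range n, (f ∘ T^[i]) ⁻¹' S (i + 1)) :=
        Finset.measurableSet_biInter _ fun i _ =>
          (hf.comp (hT.measurable.iterate i)) (hS (i + 1))
      rw [hsplit, h.measure_inter_preimage_eq_mul _ _ (hS 0) hmeas,
        hT.measure_preimage hmeas.nullMeasurableSet, ih _ fun i => hS (i + 1),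
        Finset.prod_range_succ', mul_comm]
  rw [iIndepFun_iff_measure_inter_preimage_eq_mul]
  intro s S hS
  obtain ⟨n, hn⟩ := s.exists_nat_subset_range
  -- A finite index set is padded to an initial segment by trivial events.
  have hmeas : ∀ i, MeasurableSet (if i ∈ s then S i else Set.univ) := fun i => by
    split_ifs with hi
    · exact hS i hi
    · exact MeasurableSet.univ
  have hkey := key n (fun i => if i ∈ s then S i else Set.univ) hmeas
  have hset : (⋂ i ∈ Finset.range n, (f ∘ T^[i]) ⁻¹' (if i ∈ s then S i else Set.univ)) =
      ⋂ i ∈ s, (f ∘ T^[i]) ⁻¹' S i := by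
    ext x
    simp only [Set.mem_iInter, Set.mem_preimage]
    constructor
    · intro hx i hi; simpa [hi] using hx i (hn hi)
    · intro hx i _
      by_cases hi : i ∈ s
      · simpa [hi] using hx i hi
      · simp [hi]
  rw [hset] at hkey
  rw [hkey, ← Finset.prod_subset hn]
  · refine Finset.prod_congr rfl fun i hi => ?_
    simp only [hi, if_true]
    rw [Set.preimage_comp,
      (hT.iterate i).measure_preimage (hf (hS i hi)).nullMeasurableSet]
  · intro i _ hi; simp [hi]

/-! ### The digit shift: invariant measure, fair independent digits, center of mass. -/

namespace NumberSystem

open Classical in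
/-- The shift of digits, seen as a map of the tile to itself. -/
def dragonMap (x : Fin 2 → ℝ) : Fin 2 → ℝ :=
  if dragonA *ᵥ x ∈ dragonTile then dragonA *ᵥ x else dragonA *ᵥ x - dragonDigit

open Classical in
/-- The first digit after the radix point, coded as `-1` or `1`. -/
def dragonSign (x : Fin 2 → ℝ) : ℝ := if dragonA *ᵥ x ∈ dragonTile then -1 else 1

lemma measurable_dragonMap : Measurable dragonMap := by
  classical
  exact Measurable.ite (measurable_mulVec dragonA measurableSet_dragonTile)
    (measurable_mulVec dragonA) ((measurable_mulVec dragonA).sub_const _)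

lemma measurable_dragonSign : Measurable dragonSign := by
  classical
  exact Measurable.ite (measurable_mulVec dragonA measurableSet_dragonTile)
    measurable_const measurable_const

lemma dragonMap_eq (x : Fin 2 → ℝ) :
    dragonMap x = dragonA *ᵥ x - ((1 + dragonSign x) / 2) • dragonDigit := by
  unfold dragonMap dragonSign
  split_ifs <;> simp

lemma dragonMap_mem {x : Fin 2 → ℝ} (hx : x ∈ dragonTile) : dragonMap x ∈ dragonTile := by
  unfold dragonMap
  split_ifs with h
  · exact h
  · exact (mem_dragonTile_iff_mulVec.1 hx).resolve_left h

lemma dragonMap_iterate_mem {x : Fin 2 → ℝ} (hx : x ∈ dragonTile) (n : ℕ) :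
    dragonMap^[n] x ∈ dragonTile := by
  induction n with
  | zero => exact hx
  | succ n ih => rw [Function.iterate_succ_apply']; exact dragonMap_mem ih

lemma dragonA_mulVec_sub_dragonMap_mem (x : Fin 2 → ℝ) :
    dragonA *ᵥ x - dragonMap x ∈ dragonD := by
  rw [mem_dragonD]
  unfold dragonMap
  split_ifs
  · exact .inl (sub_self _)
  · exact .inr (sub_sub_cancel _ _)

/-- For `x` in the tile this makes `T^n x` a candidate for the fractional part of `A^n x`. -/
lemma dragonA_pow_mulVec_sub_dragonMap_iterate_mem (x : Fin 2 → ℝ) (n : ℕ) :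
    (dragonA ^ n) *ᵥ x - dragonMap^[n] x ∈ integerParts n := by
  induction n with
  | zero => simp [integerParts]
  | succ n ih =>
    refine ⟨_, ih, _, dragonA_mulVec_sub_dragonMap_mem (dragonMap^[n] x), ?_⟩
    rw [Function.iterate_succ_apply', pow_succ', ← Matrix.mulVec_mulVec, Matrix.mulVec_sub]
    abel

instance isProbabilityMeasure_uniform_dragonTile : IsProbabilityMeasure (uniform dragonTile) :=
  cond_isProbabilityMeasure_of_finite volume_dragonTile_ne_zero volume_dragonTile_ne_top

lemma uniform_dragonTile_apply (s : Set (Fin 2 → ℝ)) :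
    uniform dragonTile s = (volume dragonTile)⁻¹ * volume (dragonTile ∩ s) :=
  cond_apply measurableSet_dragonTile _ _

lemma ae_uniform_of_ae {p : (Fin 2 → ℝ) → Prop} (hp : ∀ᵐ x, p x) :
    ∀ᵐ x ∂(uniform dragonTile), p x :=
  (cond_absolutelyContinuous (μ := volume) (s := dragonTile)).ae_le hp

lemma ae_uniform_mem : ∀ᵐ x ∂(uniform dragonTile), x ∈ dragonTile :=
  ae_cond_mem measurableSet_dragonTile

/-- Almost surely, any choice of fractional parts agrees with the orbit of `dragonMap`. -/
lemma ae_fracPart_eq_iterate {frac : ℕ → (Fin 2 → ℝ) → (Fin 2 → ℝ)}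
    (hfrac : ∀ i : ℕ, ∀ x ∈ dragonTile,
      IsFracPart dragonA dragonD ((dragonA ^ i) *ᵥ x) (frac i x)) :
    ∀ᵐ x ∂(uniform dragonTile), ∀ i, frac i x = dragonMap^[i] x := by
  filter_upwards [ae_uniform_of_ae ae_fracPart_unique, ae_uniform_mem] with x hx hmem i
  obtain ⟨N, hN⟩ := (hfrac i x hmem).exists_integerPart
  -- The two integer parts have lengths `N` and `i`; almost everywhere uniqueness is applied at
  -- their maximum.
  have h := hx i (max i N) _ (monotone_integerParts (le_max_right i N) hN) _
    (monotone_integerParts (le_max_left i N)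
      (dragonA_pow_mulVec_sub_dragonMap_iterate_mem x i))
    (by simpa only [sub_sub_cancel] using (hfrac i x hmem).mem_dragonTile)
    (by simpa only [sub_sub_cancel] using dragonMap_iterate_mem hmem i)
  exact sub_right_injective h

open Classical in
-- On each branch `T` is `A` up to translation, hence doubles area, and it covers the tile up to a
-- null set. Invariance (`S = univ`), fairness of the sign (`s = univ`) and independence are all
-- read off from this formula.
lemma uniform_sign_inter_map (S : Set ℝ) (s : Set (Fin 2 → ℝ)) :
    uniform dragonTile (dragonSign ⁻¹' S ∩ dragonMap ⁻¹' s) =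
      ((if (-1 : ℝ) ∈ S then 2⁻¹ else 0) + (if (1 : ℝ) ∈ S then 2⁻¹ else 0)) *
        uniform dragonTile s := by
  have hA : MeasurableSet ((fun x => dragonA *ᵥ x) ⁻¹' dragonTile) :=
    measurable_mulVec dragonA measurableSet_dragonTile
  have h1 : volume ((dragonTile ∩ (dragonSign ⁻¹' S ∩ dragonMap ⁻¹' s)) ∩
      (fun x => dragonA *ᵥ x) ⁻¹' dragonTile) =
      (if (-1 : ℝ) ∈ S then 2⁻¹ else 0) * volume (dragonTile ∩ s) := by
    split_ifs with h
    · rw [← volume_preimage_dragonA]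
      congr 1
      ext x
      simp only [Set.mem_inter_iff, Set.mem_preimage]
      constructor
      · rintro ⟨⟨-, -, hx⟩, hAx⟩
        rw [dragonMap, if_pos hAx] at hx
        exact ⟨hAx, hx⟩
      · rintro ⟨hAx, hx⟩
        refine ⟨⟨mem_dragonTile_iff_mulVec.2 (.inl hAx), ?_, ?_⟩, hAx⟩
        · rwa [dragonSign, if_pos hAx]
        · rwa [dragonMap, if_pos hAx]
    · rw [zero_mul]
      convert measure_empty (μ := volume)
      refine Set.eq_empty_of_forall_notMem ?_
      rintro x ⟨⟨-, hx, -⟩, hAx⟩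
      have hsign : dragonSign x = -1 := if_pos hAx
      exact h (hsign ▸ hx)
  have h2 : volume ((dragonTile ∩ (dragonSign ⁻¹' S ∩ dragonMap ⁻¹' s)) \
      (fun x => dragonA *ᵥ x) ⁻¹' dragonTile) =
      (if (1 : ℝ) ∈ S then 2⁻¹ else 0) * volume (dragonTile ∩ s) := by
    split_ifs with h
    -- `dragonMap` prefers the digit `0`, so the second branch loses the overlap of `F + d` with
    -- `F`, which is null.
    · have hdiff : volume ((fun x => x - dragonDigit) ⁻¹' (dragonTile ∩ s) \ dragonTile) =
          volume (dragonTile ∩ s) := by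
        rw [← volume_preimage_sub dragonDigit (dragonTile ∩ s)]
        refine measure_sdiff_null' (measure_mono_null ?_ volume_dragonTile_inter_translate)
        exact fun x hx => ⟨hx.2, hx.1.1⟩
      rw [← hdiff, ← volume_preimage_dragonA]
      congr 1
      ext x
      simp only [Set.mem_inter_iff, Set.mem_preimage, Set.mem_sdiff]
      constructor
      · rintro ⟨⟨hx, -, hxs⟩, hAx⟩
        have hx' := dragonMap_mem hx
        rw [dragonMap, if_neg hAx] at hx' hxs
        exact ⟨⟨hx', hxs⟩, hAx⟩
      · rintro ⟨⟨hx, hxs⟩, hAx⟩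
        refine ⟨⟨mem_dragonTile_iff_mulVec.2 (.inr hx), ?_, ?_⟩, hAx⟩
        · rwa [dragonSign, if_neg hAx]
        · rwa [dragonMap, if_neg hAx]
    · rw [zero_mul]
      convert measure_empty (μ := volume)
      refine Set.eq_empty_of_forall_notMem ?_
      rintro x ⟨⟨-, hx, -⟩, hAx⟩
      have hsign : dragonSign x = 1 := if_neg hAx
      exact h (hsign ▸ hx)
  rw [uniform_dragonTile_apply, uniform_dragonTile_apply,
    ← measure_inter_add_sdiff (dragonTile ∩ (_ ∩ _)) hA, h1, h2,
    ← add_mul, mul_left_comm]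

lemma measurePreserving_dragonMap :
    MeasurePreserving dragonMap (uniform dragonTile) (uniform dragonTile) := by
  refine ⟨measurable_dragonMap, Measure.ext fun s hs => ?_⟩
  rw [Measure.map_apply measurable_dragonMap hs]
  simpa [ENNReal.inv_two_add_inv_two] using uniform_sign_inter_map Set.univ s

open Classical in
lemma uniform_sign_preimage (S : Set ℝ) :
    uniform dragonTile (dragonSign ⁻¹' S) =
      (if (-1 : ℝ) ∈ S then 2⁻¹ else 0) + (if (1 : ℝ) ∈ S then 2⁻¹ else 0) := by
  simpa using uniform_sign_inter_map S Set.univ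

lemma indepFun_dragonSign_dragonMap :
    IndepFun dragonSign dragonMap (uniform dragonTile) := by
  rw [indepFun_iff_measure_inter_preimage_eq_mul]
  intro S s _ hs
  rw [uniform_sign_inter_map S s, ← uniform_sign_preimage,
    measurePreserving_dragonMap.measure_preimage hs.nullMeasurableSet]

lemma integral_dragonSign : ∫ x, dragonSign x ∂(uniform dragonTile) = 0 := by
  have hset : MeasurableSet (dragonSign ⁻¹' {-1}) :=
    measurable_dragonSign (measurableSet_singleton _)
  have hsign : dragonSign = fun x => 1 - 2 * (dragonSign ⁻¹' {-1}).indicator 1 x := by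
    funext x
    by_cases h : dragonA *ᵥ x ∈ dragonTile
    · have hx : dragonSign x = -1 := if_pos h
      simp [hx, Set.indicator]; norm_num
    · have hx : dragonSign x = 1 := if_neg h
      have : (1 : ℝ) ≠ -1 := by norm_num
      simp [hx, Set.indicator, this]
  have hreal : (uniform dragonTile).real (dragonSign ⁻¹' {-1}) = 1 / 2 := by
    have : (1 : ℝ) ≠ -1 := by norm_num
    rw [measureReal_def, uniform_sign_preimage]
    simp [this]
  have hint : Integrable (fun x => 2 * (dragonSign ⁻¹' {-1}).indicator (1 : (Fin 2 → ℝ) → ℝ) x)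
      (uniform dragonTile) := ((integrable_const (1 : ℝ)).indicator hset).const_mul 2
  calc ∫ x, dragonSign x ∂(uniform dragonTile)
      = ∫ x, 1 - 2 * (dragonSign ⁻¹' {-1}).indicator (1 : (Fin 2 → ℝ) → ℝ) x
          ∂(uniform dragonTile) := integral_congr_ae (Eventually.of_forall (congrFun hsign))
    _ = 0 := by
      rw [integral_sub (integrable_const _) hint, integral_const_mul, integral_indicator_one hset,
        hreal]
      simp

lemma dragonSign_sq (x : Fin 2 → ℝ) : dragonSign x ^ 2 = 1 := by
  unfold dragonSign; split_ifs <;> norm_num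

lemma centerOfMass_dragonTile_eq_integral :
    centerOfMass dragonTile = ∫ x, x ∂(uniform dragonTile) := by
  simp [centerOfMass, uniform, average, ProbabilityTheory.cond]

lemma integrable_id_uniform : Integrable (fun x => x) (uniform dragonTile) := by
  obtain ⟨C, hC⟩ := isCompact_dragonTile.isBounded.exists_norm_le
  exact Integrable.of_bound measurable_id.aestronglyMeasurable C
    (ae_uniform_mem.mono fun x hx => hC x hx)

lemma centerOfMass_dragonTile : centerOfMass dragonTile = ![-1 / 5, 1 / 10] := by
  set c := centerOfMass dragonTile with hc
  have hint := integrable_id_uniform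
  have hA : ∫ x, dragonA *ᵥ x ∂(uniform dragonTile) = dragonA *ᵥ c := by
    rw [hc, centerOfMass_dragonTile_eq_integral]
    exact (LinearMap.toContinuousLinearMap (Matrix.mulVecLin dragonA)).integral_comp_comm hint
  have hAint : Integrable (fun x => dragonA *ᵥ x) (uniform dragonTile) :=
    (LinearMap.toContinuousLinearMap (Matrix.mulVecLin dragonA)).integrable_comp hint
  have hsint : Integrable dragonSign (uniform dragonTile) :=
    Integrable.of_bound measurable_dragonSign.aestronglyMeasurable 1
      (Eventually.of_forall fun x => by
        rw [Real.norm_eq_abs, ← sq_le_one_iff_abs_le_one, dragonSign_sq])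
  have hdint : Integrable (fun x => (1 + dragonSign x) / 2) (uniform dragonTile) :=
    ((integrable_const _).add hsint).div_const 2
  have hT : ∫ x, dragonMap x ∂(uniform dragonTile) = c := by
    rw [hc, centerOfMass_dragonTile_eq_integral]
    conv_rhs => rw [← measurePreserving_dragonMap.map_eq]
    rw [integral_map measurable_dragonMap.aemeasurable]
    exact measurable_id.aestronglyMeasurable
  -- Integrate `T x = A x - δ(x)`: invariance of the measure gives `c` on the left, and the mean
  -- digit is `d / 2`.
  have hfix : c = dragonA *ᵥ c - (1 / 2 : ℝ) • dragonDigit := by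
    rw [← hA]
    conv_lhs => rw [← hT]
    simp_rw [dragonMap_eq]
    rw [integral_sub hAint (hdint.smul_const _), integral_smul_const, integral_div,
      integral_add (integrable_const _) hsint, integral_dragonSign]
    simp
  rw [dragonA_mulVec] at hfix
  have h0 := congrFun hfix 0
  have h1 := congrFun hfix 1
  simp [dragonDigit] at h0 h1
  ext i
  fin_cases i <;> simp <;> linarith

/-! ### Cohomological equation and central limit theorem. -/

/-- The inverse of `A - 1`. -/
def dragonC : Matrix (Fin 2) (Fin 2) ℝ := !![-2/5, -1/5; 1/5, -2/5]

lemma dragonC_mulVec (v : Fin 2 → ℝ) :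
    dragonC *ᵥ v = ![-2 / 5 * v 0 - v 1 / 5, v 0 / 5 - 2 / 5 * v 1] := by
  ext i; fin_cases i <;> simp [dragonC, Matrix.mulVec, dotProduct, Fin.sum_univ_two] <;> ring

/-- Apply `C = (A - 1)⁻¹` to `T x - x = (A - 1) x - ((1 + ε(x)) / 2) d` and use `C d = 2 x̄`. -/
lemma dragonC_mulVec_dragonMap_sub (x : Fin 2 → ℝ) :
    dragonC *ᵥ (dragonMap x - x) =
      x - centerOfMass dragonTile - dragonSign x • centerOfMass dragonTile := by
  rw [dragonMap_eq, centerOfMass_dragonTile, dragonA_mulVec, dragonC_mulVec]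
  ext i
  fin_cases i <;> simp [dragonDigit, Matrix.vecHead, Matrix.vecTail] <;> ring

lemma sum_iterate_sub (n : ℕ) (x : Fin 2 → ℝ) :
    ∑ i ∈ Finset.range n, dragonMap^[i] x - (n : ℝ) • centerOfMass dragonTile =
      (∑ i ∈ Finset.range n, dragonSign (dragonMap^[i] x)) • centerOfMass dragonTile +
        dragonC *ᵥ (dragonMap^[n] x - x) := by
  induction n with
  | zero => simp
  | succ n ih =>
    have h := dragonC_mulVec_dragonMap_sub (dragonMap^[n] x)
    rw [Finset.sum_range_succ, Finset.sum_range_succ, Function.iterate_succ_apply',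
      ← sub_add_sub_cancel (dragonMap _) (dragonMap^[n] x) x, Matrix.mulVec_add, h]
    push_cast
    rw [add_smul, add_smul, one_smul]
    linear_combination ih

/-- The signs along an orbit are i.i.d. with mean `0` and variance `1`. -/
lemma tendstoInDistribution_sum_sign :
    TendstoInDistribution
      (fun (n : ℕ) x => (√(n : ℝ))⁻¹ * ∑ i ∈ Finset.range n, dragonSign (dragonMap^[i] x))
      atTop (fun t : ℝ => t) (fun _ => uniform dragonTile) (gaussianReal 0 1) := by
  refine tendstoInDistribution_inv_sqrt_mul_sum (X := fun k => dragonSign ∘ dragonMap^[k])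
    HasLaw.id ?_ ?_ (indepFun_dragonSign_dragonMap.iIndepFun_comp_iterate measurable_dragonSign
      measurePreserving_dragonMap) fun i => ?_
  · exact integral_dragonSign
  · simp [dragonSign_sq]
  · refine ⟨(measurable_dragonSign.comp (measurable_dragonMap.iterate i)).aemeasurable,
      measurable_dragonSign.aemeasurable, ?_⟩
    rw [← Measure.map_map measurable_dragonSign (measurable_dragonMap.iterate i),
      (measurePreserving_dragonMap.iterate i).map_eq]
    rfl

/-- Orbits stay in the compact tile, so the telescoped term is bounded in `n`. -/
lemma tendsto_coboundary {x : Fin 2 → ℝ} (hx : x ∈ dragonTile) :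
    Tendsto (fun n : ℕ => (2 / √(n : ℝ)) • (dragonC *ᵥ (dragonMap^[n] x - x))) atTop (𝓝 0) := by
  obtain ⟨C, hC⟩ := ((isCompact_dragonTile.prod isCompact_dragonTile).image
    ((continuous_mulVec dragonC).comp continuous_sub)).isBounded.exists_norm_le
  have hsqrt : Tendsto (fun n : ℕ => 2 / √(n : ℝ)) atTop (𝓝 0) :=
    tendsto_const_nhds.div_atTop (Real.tendsto_sqrt_atTop.comp tendsto_natCast_atTop_atTop)
  refine hsqrt.zero_smul_isBoundedUnder_le ?_
  refine isBoundedUnder_of ⟨C, fun n => hC _ ?_⟩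
  exact ⟨(_, _), ⟨dragonMap_iterate_mem hx n, hx⟩, rfl⟩

/-! ### The limit law on the line through the center of mass. -/

/-- The limit distribution: the law of `2 Z x̄` with `Z` standard normal. -/
def dragonLimit : Measure (Fin 2 → ℝ) :=
  (gaussianReal 0 1).map fun t : ℝ => (2 * t) • centerOfMass dragonTile

lemma measurable_smul_centerOfMass :
    Measurable fun t : ℝ => (2 * t) • centerOfMass dragonTile := by fun_prop

instance isProbabilityMeasure_dragonLimit : IsProbabilityMeasure dragonLimit :=
  Measure.isProbabilityMeasure_map measurable_smul_centerOfMass.aemeasurable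

lemma tendstoInDistribution_sum_iterate :
    TendstoInDistribution
      (fun (n : ℕ) (x : Fin 2 → ℝ) => (2 / √(n : ℝ)) •
        ((∑ i ∈ Finset.range n, dragonMap^[i] x) - (n : ℝ) • centerOfMass dragonTile))
      atTop (fun p : Fin 2 → ℝ => p) (fun _ => uniform dragonTile) dragonLimit := by
  have hmain := tendstoInDistribution_sum_sign.continuous_comp
    (g := fun t : ℝ => (2 * t) • centerOfMass dragonTile) (by fun_prop)
  have hYmeas : ∀ n : ℕ, Measurable fun x =>
      (2 / √(n : ℝ)) • (dragonC *ᵥ (dragonMap^[n] x - x)) := fun n =>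
    ((measurable_mulVec dragonC).comp
      ((measurable_dragonMap.iterate n).sub measurable_id)).const_smul (2 / √(n : ℝ))
  have hY : TendstoInMeasure (uniform dragonTile)
      (fun (n : ℕ) x => (2 / √(n : ℝ)) • (dragonC *ᵥ (dragonMap^[n] x - x))) atTop
      (fun _ => (0 : Fin 2 → ℝ)) :=
    tendstoInMeasure_of_tendsto_ae (fun n => (hYmeas n).aestronglyMeasurable)
      (ae_uniform_mem.mono fun x hx => tendsto_coboundary hx)
  -- Slutsky: a term tending to `0` in measure does not affect the limit law.
  have hsum := hmain.add_of_tendstoInMeasure_const hY fun n => (hYmeas n).aemeasurable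
  have heq : (fun (n : ℕ) (x : Fin 2 → ℝ) => (2 / √(n : ℝ)) •
        ((∑ i ∈ Finset.range n, dragonMap^[i] x) - (n : ℝ) • centerOfMass dragonTile)) =
      fun n : ℕ => ((fun t : ℝ => (2 * t) • centerOfMass dragonTile) ∘ fun x => (√(n : ℝ))⁻¹ *
        ∑ i ∈ Finset.range n, dragonSign (dragonMap^[i] x)) +
        fun x => (2 / √(n : ℝ)) • (dragonC *ᵥ (dragonMap^[n] x - x)) := by
    funext n x
    simp only [sum_iterate_sub, Pi.add_apply, Function.comp_apply, smul_add, smul_smul,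
      div_eq_mul_inv, mul_assoc]
  rw [heq]
  refine ⟨hsum.forall_aemeasurable, aemeasurable_id, ?_⟩
  convert hsum.tendsto using 2
  refine congrArg 𝓝 (Subtype.ext ?_)
  simp [dragonLimit, Measure.map_id']

lemma centerOfMass_dragonTile_ne_zero : centerOfMass dragonTile ≠ 0 := by
  rw [centerOfMass_dragonTile]
  intro h
  have := congrFun h 1
  norm_num at this

lemma isClosed_halfLine_centerOfMass (k : ℝ) :
    IsClosed {p | ∃ t : ℝ, t ≤ 2 * k ∧ p = t • centerOfMass dragonTile} := by
  convert (isClosedEmbedding_smul_left centerOfMass_dragonTile_ne_zero).isClosedMap _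
    (isClosed_Iic (a := 2 * k)) using 1
  ext p
  simp [eq_comm]

lemma isClosed_line_centerOfMass :
    IsClosed {p | ∃ t : ℝ, p = t • centerOfMass dragonTile} := by
  convert (isClosedEmbedding_smul_left (𝕜 := ℝ)
    centerOfMass_dragonTile_ne_zero).isClosed_range using 1
  ext p
  simp [eq_comm]

lemma dragonLimit_line :
    dragonLimit {p | ∃ t : ℝ, p = t • centerOfMass dragonTile} = 1 := by
  rw [dragonLimit, Measure.map_apply measurable_smul_centerOfMass
    isClosed_line_centerOfMass.measurableSet]
  convert measure_univ (μ := gaussianReal 0 1)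
  exact Set.eq_univ_of_forall fun t => ⟨2 * t, rfl⟩

/-- As `x̄ ≠ 0`, the parameter on the line is unique and equals `2 Z`, so the bound `2 k` becomes `Z
≤ k`. -/
lemma dragonLimit_halfLine (k : ℝ) :
    dragonLimit.real {p | ∃ t : ℝ, t ≤ 2 * k ∧ p = t • centerOfMass dragonTile} =
      (1 / √(2 * Real.pi)) * ∫ u in Set.Iic k, Real.exp (-(1 / 2) * u ^ 2) := by
  have hpre : (fun t : ℝ => (2 * t) • centerOfMass dragonTile) ⁻¹'
      {p | ∃ t : ℝ, t ≤ 2 * k ∧ p = t • centerOfMass dragonTile} = Set.Iic k := by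
    ext t
    simp only [Set.mem_preimage, Set.mem_ofPred_eq, Set.mem_Iic]
    constructor
    · rintro ⟨u, hu, h⟩
      have := smul_left_injective ℝ centerOfMass_dragonTile_ne_zero h
      linarith
    · exact fun h => ⟨2 * t, by linarith, rfl⟩
  rw [measureReal_def, dragonLimit, Measure.map_apply measurable_smul_centerOfMass
    (isClosed_halfLine_centerOfMass k).measurableSet, hpre,
    gaussianReal_apply_eq_integral _ one_ne_zero, ENNReal.toReal_ofReal
      (integral_nonneg fun _ => gaussianPDFReal_nonneg _ _ _), ← integral_const_mul]
  congr 1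
  funext u
  simp only [gaussianPDFReal, NNReal.coe_one, mul_one, sub_zero, one_div]
  congr 2
  ring

end NumberSystem

end

theorem proposition3
    (frac : ℕ → (Fin 2 → ℝ) → (Fin 2 → ℝ))
    (hfrac : ∀ i : ℕ, ∀ x ∈ NumberSystem.dragonTile,
      NumberSystem.IsFracPart NumberSystem.dragonA NumberSystem.dragonD
        ((NumberSystem.dragonA ^ i) *ᵥ x) (frac i x)) :
    ∃ (_ : IsProbabilityMeasure (NumberSystem.uniform NumberSystem.dragonTile))
      (ν : Measure (Fin 2 → ℝ)) (_ : IsProbabilityMeasure ν),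
      TendstoInDistribution
        (fun (n : ℕ) (x : Fin 2 → ℝ) =>
          (2 / √(n : ℝ)) • ((∑ i ∈ Finset.range n, frac i x) -
            (n : ℝ) • NumberSystem.centerOfMass NumberSystem.dragonTile))
        atTop (fun p : Fin 2 → ℝ => p)
        (fun _ => NumberSystem.uniform NumberSystem.dragonTile) ν ∧
      ν {p | ∃ t : ℝ, p = t • NumberSystem.centerOfMass NumberSystem.dragonTile} = 1 ∧
      ∀ k : ℝ,
        ν.real {p | ∃ t : ℝ, t ≤ 2 * k ∧
          p = t • NumberSystem.centerOfMass NumberSystem.dragonTile} =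
        (1 / √(2 * Real.pi)) * ∫ u in Set.Iic k, Real.exp (-(1 / 2) * u ^ 2) := by
  refine ⟨inferInstance, NumberSystem.dragonLimit, inferInstance, ?_,
    NumberSystem.dragonLimit_line, NumberSystem.dragonLimit_halfLine⟩
  -- Convergence in distribution depends only on almost everywhere classes, so the arbitrary choice
  -- of fractional parts may be replaced by the orbit of `T`.
  refine NumberSystem.tendstoInDistribution_sum_iterate.congr (fun n => ?_) (ae_eq_refl _)
  filter_upwards [NumberSystem.ae_fracPart_eq_iterate hfrac] with x hx
  simp only [hx]
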